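/- For finite simple graphs $F$ and $H$, let $R(F,H)$ denote the smallest positive integer $N$ such that every red/blue coloring of the edges of the complete graph $K_N$ contains a red copy of $F$ or a blue copy of $H$ (as a not necessarily induced subgraph). Let $C_m$ be the cycle of length $m$, and let $F_n$ be the fan on $2n+1$ vertices consisting of $n$ triangles that share exactly one common vertex (the center) and are otherwise vertex-disjoint. Then: (i) $R(C_{2n}, F_n) = (4+o(1))\,n$ as $n\to\infty$; that is, there is a real sequence $\varepsilon_n\to 0$ such that $R(C_{2n},F_n)=(4+\varepsilon_n)n$ for all sufficiently large integers $n$; (ii) $R(C_n, F_n) = (3+o(1))\,n$ as $n\to\infty$ through the even integers; that is, there is a real sequence $\varepsilon_n\to 0$ such that $R(C_n,F_n)=(3+\varepsilon_n)n$ for all sufficiently large even integers $n$. -/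

import Mathlib

/-!
For the lower bounds, colour the edges of a complete multipartite graph blue, with parts too small
to contain the red cycle. With two parts there is no blue triangle, and with three parts every blade
of a blue fan has one end in each of the two parts avoiding the center, which are smaller than `n`.

For the upper bounds, let `G` be the red graph on `N` vertices, and suppose that it has no `C_{2m}`
while its complement has no `F_n`. The blue neighbourhood of a vertex has no blue matching of size
`n`, and if it had more than `2n + m` vertices, this would force a red `C_{2m}` inside it; so all
red degrees are at least `m + εN`. Apply the regularity lemma to `G`. A connected component of the
cluster graph covering more than `2m + o(N)` vertices has a matching of clusters covering `2m`
vertices, since all degrees in it are large, and Łuczak's connected matching method turns this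
matching into a red `C_{2m}`. Hence almost all vertices split into classes of sizes between
`m + εN` and `2m + o(N)`, with only `o(N²)` red edges between distinct classes. Choose a vertex with
few red edges to the other classes: they are too large, and no single one of them is too dominant,
for its blue neighbourhood not to contain a blue matching of size `n`, which gives a fan.
-/

/-- `RamseyArrows F H N`: every red/blue coloring of the edges of the complete graph on `N` vertices
contains a red copy of `F` or a blue copy of `H` (not necessarily induced).
Label `1` is red and label `0` is blue. -/
def RamseyArrows {α β : Type*} (F : SimpleGraph α) (H : SimpleGraph β) (N : ℕ) : Prop :=
  ∀ C : SimpleGraph.TopEdgeLabeling (Fin N) (Fin 2),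
    F.IsContained (C.labelGraph 1) ∨ H.IsContained (C.labelGraph 0)

/-- The Ramsey number `R(F, H)`: the smallest positive integer `N` such that every red/blue coloring
of the edges of `K_N` contains a red `F` or a blue `H`. -/
noncomputable def ramseyNumber {α β : Type*} (F : SimpleGraph α) (H : SimpleGraph β) : ℕ :=
  sInf {N : ℕ | 0 < N ∧ RamseyArrows F H N}

/-- The fan `F_n`: `n` triangles sharing exactly one common vertex. The center is `none`, and the
`i`-th blade is the edge joining `some (i, false)` and `some (i, true)`. -/
def fanGraph (n : ℕ) : SimpleGraph (Option (Fin n × Bool)) where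
  Adj
    | none, none => False
    | none, some _ => True
    | some _, none => True
    | some p, some q => p.1 = q.1 ∧ p.2 ≠ q.2
  symm := ⟨by
    rintro (_ | p) (_ | q) h
    · exact h
    · trivial
    · trivial
    · exact ⟨h.1.symm, h.2.symm⟩⟩
  loopless := ⟨by
    rintro (_ | p) h
    · exact h
    · exact h.2 rfl⟩

namespace CycleFan

open Finset SimpleGraph

section Ramsey

variable {α β : Type*} {F : SimpleGraph α} {H : SimpleGraph β} {N : ℕ}

theorem ramseyArrows_iff : RamseyArrows F H N ↔ ∀ G : SimpleGraph (Fin N), F ⊑ G ∨ H ⊑ Gᶜ := by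
  classical
  refine ⟨fun h G ↦ ?_, fun h C ↦ ?_⟩
  · simpa using h G.toTopEdgeLabeling
  · have hC := h (C.labelGraph 1)
    rwa [← toTopEdgeLabeling_labelGraph_compl, TopEdgeLabeling.labelGraph_toTopEdgeLabeling] at hC

theorem ramseyNumber_le_of_ramseyArrows (hN : 0 < N) (h : RamseyArrows F H N) :
    ramseyNumber F H ≤ N :=
  Nat.sInf_le ⟨hN, h⟩

theorem lt_ramseyNumber {M : ℕ} (hM : 0 < M) (h : RamseyArrows F H M)
    (hN : ∀ k ≤ N, ¬ RamseyArrows F H k) : N < ramseyNumber F H := by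
  by_contra! hle
  exact hN _ hle (Nat.sInf_mem (s := {N | 0 < N ∧ RamseyArrows F H N}) ⟨M, hM, h⟩).2

end Ramsey

section LowerBound

variable {N r s : ℕ}

theorem card_mod_eq_le (hN : N ≤ r * s) (c : ℕ) : #{x : Fin N | x.val % r = c} ≤ s := by
  rw [← card_range s]
  refine card_le_card_of_injOn (fun x ↦ x.val / r)
    (fun x _ ↦ mem_coe.2 <| mem_range.2 <| Nat.div_lt_of_lt_mul (x.2.trans_le hN)) ?_
  intro x hx y hy hxy
  simp only [coe_filter_univ, Set.mem_ofPred_eq] at hx hy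
  exact Fin.ext (by rw [← Nat.div_add_mod x.val r, ← Nat.div_add_mod y.val r, hx, hy]; simp_all)

theorem card_le_of_isContained_compl_turanGraph {β : Type*} [Fintype β] {F : SimpleGraph β}
    (hF : F.Preconnected) (hN : N ≤ r * s) (h : F ⊑ (turanGraph N r)ᶜ) :
    Fintype.card β ≤ s := by
  obtain ⟨f⟩ := h
  obtain hβ | ⟨⟨b⟩⟩ := isEmpty_or_nonempty β
  · simp
  have same_class (x : β) : (f x).val % r = (f b).val % r := by
    obtain ⟨p⟩ := hF x b
    induction p with
    | nil => rfl
    | cons hadj _ ih =>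
      have hnot := (compl_adj _ _ _).1 (f.toHom.map_adj hadj)
      exact (of_not_not hnot.2).trans ih
  rw [← card_univ, ← card_map f.toEmbedding]
  refine (card_le_card fun y hy ↦ ?_).trans (card_mod_eq_le hN ((f b).val % r))
  obtain ⟨x, -, rfl⟩ := mem_map.1 hy
  exact (mem_filter_univ _).2 (same_class x)

theorem le_of_fanGraph_isContained_of_coloring {α κ : Type*} [Fintype α] [Fintype κ]
    [DecidableEq κ] {G : SimpleGraph α} (C : G.Coloring κ) (hC : ∀ c, #{x | C x = c} ≤ s) {n : ℕ}
    (h : fanGraph n ⊑ G) : n ≤ (Fintype.card κ - 2) * s := by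
  obtain ⟨f⟩ := h
  obtain rfl | hn := n.eq_zero_or_pos
  · exact Nat.zero_le _
  have center_ne (x) : C (f none) ≠ C (f (some x)) := C.valid (f.toHom.map_adj trivial)
  have blade_ne (i) : C (f (some (i, false))) ≠ C (f (some (i, true))) :=
    C.valid (f.toHom.map_adj ⟨rfl, Bool.false_ne_true⟩)
  let c := C (f none)
  let d := C (f (some (⟨0, hn⟩, false)))
  have exists_end (i) : ∃ b, C (f (some (i, b))) ∉ ({c, d} : Finset κ) := by
    by_contra! hall
    have hd (b) : C (f (some (i, b))) = d := by
      have hb := hall b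
      rw [mem_insert, mem_singleton] at hb
      exact hb.resolve_left (center_ne _).symm
    exact blade_ne i ((hd false).trans (hd true).symm)
  choose b hb using exists_end
  calc n = #(univ : Finset (Fin n)) := by simp
    _ ≤ #{x | C x ∈ ({c, d} : Finset κ)ᶜ} := by
      refine card_le_card_of_injOn (fun i ↦ f (some (i, b i))) (fun i _ ↦ by simpa using hb i) ?_
      intro i _ j _ hij
      exact congrArg Prod.fst (Option.some_injective _ (f.injective hij))
    _ ≤ s * #({c, d} : Finset κ)ᶜ :=
      card_le_mul_card_image_of_maps_to (f := C) (fun x hx ↦ (mem_filter.1 hx).2) s fun e _ ↦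
        (card_le_card (filter_subset_filter _ (subset_univ _))).trans (hC e)
    _ = (Fintype.card κ - 2) * s := by
      rw [card_compl, card_pair (center_ne _), mul_comm]

/-- Colour the edges of `turanGraph N (b + 2)` blue. -/
theorem not_ramseyArrows_fanGraph {β : Type*} [Fintype β] {F : SimpleGraph β}
    (hF : F.Preconnected) {b n : ℕ} (hN : N ≤ (b + 2) * s) (hs : s < Fintype.card β)
    (hn : b * s < n) : ¬ RamseyArrows F (fanGraph n) N := by
  rw [ramseyArrows_iff]
  intro h
  rcases h (turanGraph N (b + 2))ᶜ with hred | hblue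
  · exact hs.not_ge (card_le_of_isContained_compl_turanGraph hF hN hred)
  · rw [compl_compl] at hblue
    let C : (turanGraph N (b + 2)).Coloring (Fin (b + 2)) :=
      Coloring.mk (fun x ↦ Fin.ofNat (b + 2) x.val) fun hadj heq ↦ hadj (congrArg Fin.val heq)
    have hle := le_of_fanGraph_isContained_of_coloring (s := s) C (fun c ↦ ?_) hblue
    · simp only [Fintype.card_fin, Nat.add_sub_cancel] at hle
      exact hn.not_ge hle
    · refine le_trans (card_le_card fun x hx ↦ ?_) (card_mod_eq_le hN c.val)
      simp only [mem_filter_univ] at hx ⊢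
      exact congrArg Fin.val hx

end LowerBound

section Matching

/-- The family `g` is a matching of `G` inside `W`: its edges, indexed by `ι`, are the pairs
`g (i, false)`, `g (i, true)`. -/
structure IsMatchingIn {α ι : Type*} (G : SimpleGraph α) (W : Finset α) (g : ι × Bool → α) :
    Prop where
  injective : Function.Injective g
  mem : ∀ x, g x ∈ W
  adj : ∀ i, G.Adj (g (i, false)) (g (i, true))

/-- `G` has a matching with `r` edges inside `W`. -/
def HasMatching {α : Type*} (G : SimpleGraph α) (W : Finset α) (r : ℕ) : Prop :=
  ∃ g : Fin r × Bool → α, IsMatchingIn G W g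

/-- A matching of `G` inside `W` with the largest possible number of edges. -/
structure IsMaximumMatchingIn {α : Type*} (G : SimpleGraph α) (W : Finset α) {r : ℕ}
    (g : Fin r × Bool → α) : Prop extends IsMatchingIn G W g where
  not_hasMatching_succ : ¬ HasMatching G W (r + 1)

open Classical in
/-- The vertices of `W` missed by the family `g`. -/
noncomputable def uncovered {α κ : Type*} (W : Finset α) (g : κ → α) : Finset α :=
  {u ∈ W | u ∉ Set.range g}

variable {α : Type*} {G : SimpleGraph α} {W : Finset α} {r : ℕ}

theorem mem_uncovered {κ : Type*} {g : κ → α} {u : α} :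
    u ∈ uncovered W g ↔ u ∈ W ∧ u ∉ Set.range g := by
  classical exact mem_filter

theorem uncovered_subset {κ : Type*} (g : κ → α) : uncovered W g ⊆ W :=
  fun _ hu ↦ (mem_uncovered.1 hu).1

namespace IsMatchingIn

theorem hasMatching {ι : Type*} [Fintype ι] {g : ι × Bool → α} (hg : IsMatchingIn G W g) :
    HasMatching G W (Fintype.card ι) := by
  let e := (Fintype.equivFin ι).symm.prodCongr (Equiv.refl Bool)
  exact ⟨g ∘ e, hg.injective.comp e.injective, fun x ↦ hg.mem _, fun i ↦ hg.adj _⟩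

theorem card_uncovered_add {g : Fin r × Bool → α} (hg : IsMatchingIn G W g) :
    #(uncovered W g) + 2 * r = #W := by
  classical
  have himage : univ.image g ⊆ W := image_subset_iff.2 fun x _ ↦ hg.mem x
  have hcard : #(univ.image g) = 2 * r := by
    simp [card_image_of_injective _ hg.injective, mul_comm]
  have huncovered : uncovered W g = W \ univ.image g := by ext u; simp [mem_uncovered]
  rw [huncovered, ← hcard, card_sdiff_add_card_eq_card himage]

variable {g : Fin r × Bool → α} {u v : α}

theorem hasMatching_succ (hg : IsMatchingIn G W g) (hu : u ∈ uncovered W g)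
    (hv : v ∈ uncovered W g) (huv : G.Adj u v) : HasMatching G W (r + 1) := by
  rw [mem_uncovered] at hu hv
  let e := Equiv.sumProdDistrib (Fin r) Unit Bool
  let g' : (Fin r × Bool) ⊕ (Unit × Bool) → α := Sum.elim g fun x ↦ bif x.2 then v else u
  have hg' : IsMatchingIn G W (g' ∘ e) := by
    refine ⟨(hg.injective.sumElim ?_ ?_).comp e.injective, fun x ↦ ?_, ?_⟩
    · rintro ⟨⟨⟩, _ | _⟩ ⟨⟨⟩, _ | _⟩ h
      exacts [rfl, absurd h huv.ne, absurd h huv.ne', rfl]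
    · rintro x ⟨⟨⟩, _ | _⟩ h
      exacts [hu.2 ⟨x, h⟩, hv.2 ⟨x, h⟩]
    · change g' (e x) ∈ W
      rcases e x with y | ⟨⟨⟩, _ | _⟩
      exacts [hg.mem y, hu.1, hv.1]
    · rintro (i | -)
      exacts [hg.adj i, huv]
  simpa using hg'.hasMatching

/-- The path `u`, `g (i, b)`, `g (i, !b)`, `v` is augmenting. -/
theorem hasMatching_succ_of_augment (hg : IsMatchingIn G W g) (hu : u ∈ uncovered W g)
    (hv : v ∈ uncovered W g) (huv : u ≠ v) {i : Fin r} {b : Bool} (hub : G.Adj u (g (i, b)))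
    (hvb : G.Adj v (g (i, !b))) : HasMatching G W (r + 1) := by
  classical
  rw [mem_uncovered] at hu hv
  simp only [Set.mem_range, not_exists] at hu hv
  have hne : g (i, !b) ≠ g (i, b) := hg.injective.ne (by simp)
  have hg' : IsMatchingIn G W (Function.update g (i, !b) u) := by
    refine ⟨fun x y hxy ↦ ?_, fun x ↦ ?_, fun j ↦ ?_⟩
    · grind [Function.update_apply, hg.injective.eq_iff]
    · grind [Function.update_apply, hg.mem x]
    · obtain rfl | hj := eq_or_ne j i
      · cases b
        · simpa using hub.symm
        · simpa using hub
      · simpa [hj] using hg.adj j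
  refine hg'.hasMatching_succ (mem_uncovered.2 ⟨hv.1, ?_⟩)
    (mem_uncovered.2 ⟨hg.mem (i, !b), ?_⟩) hvb
  · rintro ⟨x, hx⟩
    grind [Function.update_apply]
  · rintro ⟨x, hx⟩
    grind [Function.update_apply, hg.injective.eq_iff]

end IsMatchingIn

theorem hasMatching_zero : HasMatching G W 0 :=
  ⟨fun x ↦ x.1.elim0, fun x ↦ x.1.elim0, fun x ↦ x.1.elim0, fun i ↦ i.elim0⟩

theorem exists_isMaximumMatchingIn {n : ℕ} (h : ¬ HasMatching G W n) :
    ∃ r < n, ∃ g : Fin r × Bool → α, IsMaximumMatchingIn G W g := by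
  classical
  have hex : ∃ k, ¬ HasMatching G W k := ⟨n, h⟩
  have hpos : 0 < Nat.find hex := (Nat.find_pos hex).2 (not_not.2 hasMatching_zero)
  obtain ⟨r, hr⟩ := Nat.exists_eq_add_one.2 hpos
  obtain ⟨g, hg⟩ := not_not.1 (Nat.find_min hex (m := r) (by omega))
  refine ⟨r, ?_, g, hg, ?_⟩
  · have hle := Nat.find_min' hex h
    omega
  · rw [← hr]
    exact Nat.find_spec hex

namespace IsMaximumMatchingIn

variable {g : Fin r × Bool → α} {u v : α}

theorem not_adj (hg : IsMaximumMatchingIn G W g) (hu : u ∈ uncovered W g)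
    (hv : v ∈ uncovered W g) : ¬ G.Adj u v :=
  fun huv ↦ hg.not_hasMatching_succ (hg.hasMatching_succ hu hv huv)

theorem not_adj_of_adj (hg : IsMaximumMatchingIn G W g) (hu : u ∈ uncovered W g)
    (hv : v ∈ uncovered W g) (huv : u ≠ v) {i : Fin r} {b : Bool} (hub : G.Adj u (g (i, b))) :
    ¬ G.Adj v (g (i, !b)) :=
  fun hvb ↦ hg.not_hasMatching_succ (hg.hasMatching_succ_of_augment hu hv huv hub hvb)

theorem exists_card_adj_uncovered_le_one [DecidableRel G.Adj] (hg : IsMaximumMatchingIn G W g)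
    (i : Fin r) : ∃ b, #{u ∈ uncovered W g | G.Adj (g (i, b)) u} ≤ 1 := by
  by_contra! h
  obtain ⟨u, hu⟩ := card_pos.1 (zero_lt_one.trans (h false))
  obtain ⟨v, hv, hvu⟩ := exists_mem_ne (h true) u
  rw [mem_filter] at hu hv
  exact hg.not_adj_of_adj hu.1 hv.1 hvu.symm hu.2.symm hv.2.symm

theorem exists_transversal [DecidableRel G.Adj] (hg : IsMaximumMatchingIn G W g) :
    ∃ X : Finset α, #X = r ∧ Disjoint X (uncovered W g) ∧
      ∀ x ∈ X, #{u ∈ uncovered W g | G.Adj x u} ≤ 1 := by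
  classical
  choose b hb using hg.exists_card_adj_uncovered_le_one
  refine ⟨univ.image fun i ↦ g (i, b i), ?_, ?_, ?_⟩
  · rw [card_image_of_injective _ fun i j hij ↦ congrArg Prod.fst (hg.injective hij), card_univ,
      Fintype.card_fin]
  · simp only [Finset.disjoint_left, mem_image, mem_univ, true_and, mem_uncovered]
    rintro _ ⟨i, rfl⟩ h
    exact h.2 ⟨_, rfl⟩
  · intro x hx
    obtain ⟨i, -, rfl⟩ := mem_image.1 hx
    exact hb i

theorem card_adj_le [DecidableRel G.Adj] (hg : IsMaximumMatchingIn G W g)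
    (hu : u ∈ uncovered W g) : #{w ∈ W | G.Adj u w} ≤ #{x | G.Adj u (g x)} := by
  classical
  refine le_trans (card_le_card (t := image g {x | G.Adj u (g x)}) fun w hw ↦ ?_) card_image_le
  rw [mem_filter] at hw
  by_cases hwg : w ∈ Set.range g
  · obtain ⟨x, rfl⟩ := hwg
    exact mem_image_of_mem g ((mem_filter_univ x).2 hw.2)
  · exact absurd hw.2 (hg.not_adj hu (mem_uncovered.2 ⟨hw.1, hwg⟩))

end IsMaximumMatchingIn

theorem hasMatching_of_le_card_adj [DecidableRel G.Adj] {t : ℕ} (hW : 2 * t ≤ #W)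
    (hdeg : ∀ u ∈ W, t ≤ #{v ∈ W | G.Adj u v}) : HasMatching G W t := by
  by_contra h
  obtain ⟨r, hr, g, hg⟩ := exists_isMaximumMatchingIn h
  have hcard := hg.card_uncovered_add
  obtain ⟨u, hu, v, hv, huv⟩ := one_lt_card.1 (show 1 < #(uncovered W g) by omega)
  have hswap : #{x | G.Adj u (g x)} ≤ #{x | ¬ G.Adj v (g x)} := by
    refine card_le_card_of_injOn (fun x ↦ (x.1, !x.2)) (fun x hx ↦ ?_) fun x _ y _ hxy ↦ ?_
    · simp only [coe_filter_univ, Set.mem_ofPred_eq] at hx ⊢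
      exact hg.not_adj_of_adj hu hv huv hx
    · simpa [Prod.ext_iff] using hxy
  have hu' := (hdeg u (uncovered_subset g hu)).trans (hg.card_adj_le hu)
  have hv' := (hdeg v (uncovered_subset g hv)).trans (hg.card_adj_le hv)
  have htotal := card_filter_add_card_filter_not (s := univ) fun x ↦ G.Adj v (g x)
  rw [card_univ, Fintype.card_prod, Fintype.card_fin, Fintype.card_bool] at htotal
  omega

theorem fanGraph_isContained_of_hasMatching {v : α} {n : ℕ} (hv : ∀ w ∈ W, G.Adj v w)
    (h : HasMatching G W n) : fanGraph n ⊑ G := by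
  obtain ⟨g, hg⟩ := h
  refine ⟨⟨⟨fun x ↦ x.elim v g, ?_⟩, ?_⟩⟩
  · rintro (_ | ⟨i, a⟩) (_ | ⟨j, b⟩) h
    · exact absurd h (fanGraph n).irrefl
    · exact hv _ (hg.mem _)
    · exact (hv _ (hg.mem _)).symm
    · obtain ⟨rfl, hab⟩ : i = j ∧ a ≠ b := h
      cases a <;> cases b
      exacts [absurd rfl hab, hg.adj i, (hg.adj i).symm, absurd rfl hab]
  · rintro (_ | x) (_ | y) h
    · rfl
    · exact absurd h (hv _ (hg.mem y)).ne
    · exact absurd h (hv _ (hg.mem x)).ne'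
    · exact congrArg some (hg.injective h)

end Matching

section CycleOrMatching

variable {α : Type*} {G : SimpleGraph α} {m n : ℕ}

theorem cycleGraph_isContained_of_closed_seq {L : ℕ} {f : ℕ → α}
    (hinj : Set.InjOn f (Set.Iio L)) (hadj : ∀ i < L, G.Adj (f i) (f (i + 1)))
    (hclosed : f L = f 0) : cycleGraph L ⊑ G := by
  have adj_of_sub_eq_one (u v : Fin L) (h : (u - v).val = 1) : G.Adj (f v) (f u) := by
    rw [Fin.sub_def] at h
    dsimp only at h
    rcases lt_or_ge (L - v.val + u.val) L with hlt | hge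
    · rw [Nat.mod_eq_of_lt hlt] at h
      have hclosed' : f (v.val + 1) = f 0 := hclosed ▸ congrArg f (by omega)
      rw [show u.val = 0 by omega, ← hclosed']
      exact hadj _ v.2
    · rw [Nat.mod_eq_sub_mod hge, Nat.mod_eq_of_lt (by omega)] at h
      rw [show u.val = v.val + 1 by omega]
      exact hadj _ v.2
  refine ⟨⟨⟨fun i ↦ f i, fun {u v} h ↦ ?_⟩, fun u v h ↦ Fin.ext (hinj u.2 v.2 h)⟩⟩
  rcases cycleGraph_adj'.1 h with h | h
  · exact (adj_of_sub_eq_one u v h).symm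
  · exact adj_of_sub_eq_one v u h

theorem cycleGraph_isContained_of_interleave {y z : ℕ → α} (hy : Set.InjOn y (Set.Iio m))
    (hz : Set.InjOn z (Set.Iio m)) (hyz : ∀ i j, y i ≠ z j)
    (hadj : ∀ i < m, G.Adj (y i) (z i)) (hadj_succ : ∀ i < m, G.Adj (z i) (y (i + 1)))
    (hclosed : y m = y 0) : cycleGraph (2 * m) ⊑ G := by
  refine cycleGraph_isContained_of_closed_seq
    (f := fun j ↦ if Even j then y (j / 2) else z (j / 2)) ?_ (fun j hj ↦ ?_) (by simpa)
  · intro i hi j hj hij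
    simp only [Set.mem_Iio] at hi hj
    by_cases hie : Even i <;> by_cases hje : Even j <;>
      simp only [hie, hje, if_true, if_false] at hij
    · have := hy (Set.mem_Iio.2 (by omega)) (Set.mem_Iio.2 (by omega)) hij
      grind
    · exact absurd hij (hyz _ _)
    · exact absurd hij.symm (hyz _ _)
    · have := hz (Set.mem_Iio.2 (by omega)) (Set.mem_Iio.2 (by omega)) hij
      grind
  · by_cases hje : Even j
    · have hhalf : (j + 1) / 2 = j / 2 := by grind
      simpa [hje, Nat.even_add_one, hhalf] using hadj (j / 2) (by omega)
    · have hhalf : (j + 1) / 2 = j / 2 + 1 := by grind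
      simpa [hje, Nat.even_add_one, hhalf] using hadj_succ (j / 2) (by omega)

theorem cycleGraph_isContained_of_card_not_adj_le_one [DecidableRel G.Adj] {Y U : Finset α}
    (hY : 2 ≤ #Y) (hU : #Y + 2 ≤ #U) (hYU : Disjoint Y U)
    (h : ∀ y ∈ Y, #{u ∈ U | ¬ G.Adj y u} ≤ 1) : cycleGraph (2 * #Y) ⊑ G := by
  classical
  obtain ⟨m, hm⟩ : ∃ m, #Y = m := ⟨_, rfl⟩
  have hm0 : 0 < m := by omega
  rw [hm] at hU ⊢
  let y (i : ℕ) : α := (Y.equivFinOfCardEq hm).symm ⟨i % m, Nat.mod_lt i hm0⟩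
  have hyY (i) : y i ∈ Y := Subtype.coe_prop _
  let common (i : Fin m) : Finset α := {u ∈ U | G.Adj (y i) u ∧ G.Adj (y (i + 1)) u}
  have hcommon (i) : m ≤ #(common i) := by
    have hcover : U ⊆ common i ∪ ({u ∈ U | ¬ G.Adj (y i) u} ∪ {u ∈ U | ¬ G.Adj (y (i + 1)) u}) := by
      intro u hu
      simp only [common, mem_union, mem_filter, hu, true_and]
      tauto
    have hcard := (card_le_card hcover).trans (card_union_le _ _)
    have hsum := card_union_le {u ∈ U | ¬ G.Adj (y i) u} {u ∈ U | ¬ G.Adj (y (i + 1)) u}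
    have h₁ := h _ (hyY i)
    have h₂ := h _ (hyY (i + 1))
    omega
  obtain ⟨z, hz, hzmem⟩ : ∃ z : Fin m → α, z.Injective ∧ ∀ i, z i ∈ common i := by
    refine (all_card_le_biUnion_card_iff_exists_injective common).1 fun s ↦ ?_
    obtain rfl | ⟨i, hi⟩ := s.eq_empty_or_nonempty
    · simp
    · calc #s ≤ m := by simpa using card_le_univ s
        _ ≤ #(common i) := hcommon i
        _ ≤ #(s.biUnion common) := card_le_card (subset_biUnion_of_mem common hi)
  simp only [common, mem_filter] at hzmem
  refine cycleGraph_isContained_of_interleave (y := y)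
    (z := fun i ↦ z ⟨i % m, Nat.mod_lt i hm0⟩) ?_ ?_
    (fun i j hij ↦ Finset.disjoint_left.1 hYU (hyY i) (hij ▸ (hzmem _).1)) (fun i hi ↦ ?_)
    (fun i hi ↦ ?_) (by simp [y])
  · intro i hi j hj hij
    simpa [y, Nat.mod_eq_of_lt hi, Nat.mod_eq_of_lt hj] using hij
  · intro i hi j hj hij
    simpa [Nat.mod_eq_of_lt hi, Nat.mod_eq_of_lt hj] using hz hij
  · simpa only [Nat.mod_eq_of_lt hi] using (hzmem ⟨i, hi⟩).2.1
  · simpa only [Nat.mod_eq_of_lt hi] using (hzmem ⟨i, hi⟩).2.2.symm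

theorem hasMatching_compl_or_cycleGraph_isContained {W : Finset α} (hm : 2 ≤ m) (hmn : m ≤ n)
    (hW : 2 * n + m + 1 ≤ #W) : HasMatching Gᶜ W n ∨ cycleGraph (2 * m) ⊑ G := by
  classical
  rw [or_iff_not_imp_left]
  intro hnot
  obtain ⟨r, hr, g, hg⟩ := exists_isMaximumMatchingIn hnot
  have hcard := hg.card_uncovered_add
  obtain ⟨U, hU⟩ : ∃ U, uncovered W g = U := ⟨_, rfl⟩
  obtain ⟨X, hX, hXU, hXone⟩ := hg.exists_transversal
  rw [hU] at hcard hXU hXone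
  have hone : ∀ x ∈ X ∪ U, #{u ∈ U | Gᶜ.Adj x u} ≤ 1 := by
    intro x hx
    rcases mem_union.1 hx with hx | hx
    · exact hXone x hx
    · rw [filter_false_of_mem fun u hu ↦ hg.not_adj (hU ▸ hx) (hU ▸ hu)]
      simp
  obtain ⟨X', hX', hX'card⟩ := exists_subset_card_eq (show min m r ≤ #X by omega)
  obtain ⟨U', hU', hU'card⟩ := exists_subset_card_eq (show m - min m r ≤ #U by omega)
  have hY : #(X' ∪ U') = m := by
    rw [card_union_of_disjoint (disjoint_of_subset_left hX' (disjoint_of_subset_right hU' hXU))]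
    omega
  have hYU : Disjoint (X' ∪ U') (U \ U') :=
    disjoint_union_left.2 ⟨disjoint_of_subset_left hX' (disjoint_of_subset_right sdiff_subset hXU),
      disjoint_sdiff⟩
  rw [← hY]
  refine cycleGraph_isContained_of_card_not_adj_le_one (by omega) ?_ hYU fun y hy ↦ ?_
  · rw [hY, card_sdiff_of_subset hU']
    omega
  · refine le_trans (card_le_card fun u hu ↦ ?_) (hone y (union_subset_union hX' hU' hy))
    rw [mem_filter] at hu ⊢
    have hyu : y ≠ u := fun h ↦ Finset.disjoint_left.1 hYU hy (h ▸ hu.1)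
    exact ⟨(mem_sdiff.1 hu.1).1, (compl_adj _ _ _).2 ⟨hyu, hu.2⟩⟩

end CycleOrMatching

section DoubleCounting

variable {α β : Type*} {r : α → β → Prop} [∀ a, DecidablePred (r a)] {s : Finset α} {t : Finset β}

theorem card_interedges_eq_sum : #(Rel.interedges r s t) = ∑ a ∈ s, #{b ∈ t | r a b} := by
  simp only [Rel.interedges, card_filter, sum_product]

theorem mul_card_le_card_interedges {n : ℕ} (h : ∀ a ∈ s, n ≤ #{b ∈ t | r a b}) :
    n * #s ≤ #(Rel.interedges r s t) := by
  rw [card_interedges_eq_sum, mul_comm]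
  exact card_nsmul_le_sum s _ n h

end DoubleCounting

section CrossEdges

variable {α κ : Type*} [DecidableEq κ] {G : SimpleGraph α} [DecidableRel G.Adj] {f : α → κ}
  {S W : Finset α} {n t : ℕ}

/-- The edges of `G` inside `S` between vertices of different labels, each counted in both
directions. -/
def crossEdges (G : SimpleGraph α) [DecidableRel G.Adj] (f : α → κ) (S : Finset α) :
    Finset (α × α) :=
  {p ∈ S ×ˢ S | f p.1 ≠ f p.2 ∧ G.Adj p.1 p.2}

theorem crossEdges_mono (h : W ⊆ S) : crossEdges G f W ⊆ crossEdges G f S :=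
  filter_subset_filter _ (product_subset_product h h)

theorem mul_card_le_card_crossEdges {I : Finset α} (hI : I ⊆ S)
    (h : ∀ x ∈ I, t ≤ #{y ∈ S | f x ≠ f y ∧ G.Adj x y}) : t * #I ≤ #(crossEdges G f S) := by
  refine (mul_card_le_card_interedges h).trans (card_le_card fun p hp ↦ ?_)
  rw [Rel.interedges, mem_filter, mem_product] at hp
  exact mem_filter.2 ⟨mem_product.2 ⟨hI hp.1.1, hp.1.2⟩, hp.2⟩

theorem exists_card_cross_adj_lt (hS : t ≤ #S) (h : #(crossEdges G f S) < t * t) :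
    ∃ x ∈ S, #{y ∈ S | f x ≠ f y ∧ G.Adj x y} < t := by
  by_contra! hall
  exact h.not_ge ((Nat.mul_le_mul_left t hS).trans (mul_card_le_card_crossEdges subset_rfl hall))

/-- Uncovered vertices with different labels are joined by an edge of `G`. -/
theorem exists_card_uncovered_label_ne_lt {r : ℕ} {g : Fin r × Bool → α}
    (hg : IsMaximumMatchingIn Gᶜ W g) (ht : t ≤ #(uncovered W g))
    (h : #(crossEdges G f W) < t * t) :
    ∃ x ∈ uncovered W g, #{u ∈ uncovered W g | f u ≠ f x} < t := by
  obtain ⟨x, hx, hxt⟩ := exists_card_cross_adj_lt ht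
    ((card_le_card (crossEdges_mono (uncovered_subset g))).trans_lt h)
  refine ⟨x, hx, lt_of_le_of_lt (card_le_card fun u hu ↦ ?_) hxt⟩
  rw [mem_filter] at hu ⊢
  have hxu : x ≠ u := fun h ↦ hu.2 (congrArg f h.symm)
  have hadj := hg.not_adj hx hu.1
  rw [compl_adj, not_and, not_not] at hadj
  exact ⟨hu.1, hu.2.symm, hadj hxu⟩

theorem card_filter_prod_bool_le {ι : Type*} [Fintype ι] (q : ι × Bool → Prop) [DecidablePred q] :
    #{p | q p} ≤ Fintype.card ι + #{i | ∀ b, q (i, b)} := by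
  rw [card_filter, Fintype.sum_prod_type, card_filter, ← card_univ, card_eq_sum_ones,
    ← sum_add_distrib]
  refine sum_le_sum fun i _ ↦ ?_
  simp only [Fintype.sum_bool, Bool.forall_bool]
  split_ifs <;> simp_all

/-- A matching edge avoiding the dominant label `c` of the uncovered vertices has an endpoint that
is joined in `G` to nearly all of them. -/
theorem card_matchingEdges_avoiding_lt {r : ℕ} {g : Fin r × Bool → α}
    (hg : IsMaximumMatchingIn Gᶜ W g) {c : κ} (hc : t + 1 ≤ #{u ∈ uncovered W g | f u = c})
    (h : #(crossEdges G f W) < t * t) : #{i | ∀ b, f (g (i, b)) ≠ c} < t := by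
  classical
  by_contra! hle
  choose b hb using hg.exists_card_adj_uncovered_le_one
  let I : Finset α := image (fun i ↦ g (i, b i)) {i | ∀ b, f (g (i, b)) ≠ c}
  have hI : t ≤ #I := by
    rwa [card_image_of_injective _ fun i j hij ↦ congrArg Prod.fst (hg.injective hij)]
  have hIW : I ⊆ W := image_subset_iff.2 fun i _ ↦ hg.mem _
  refine h.not_ge ((Nat.mul_le_mul_left t hI).trans (mul_card_le_card_crossEdges hIW ?_))
  simp only [I, mem_image, mem_filter_univ]
  rintro _ ⟨i, hi, rfl⟩
  have hcover : ({u ∈ uncovered W g | f u = c} : Finset α) ⊆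
      {u ∈ uncovered W g | Gᶜ.Adj (g (i, b i)) u} ∪
        {u ∈ W | f (g (i, b i)) ≠ f u ∧ G.Adj (g (i, b i)) u} := by
    intro u hu
    rw [mem_filter] at hu
    have hne : f (g (i, b i)) ≠ f u := hu.2 ▸ hi (b i)
    by_cases hadj : G.Adj (g (i, b i)) u
    · exact mem_union_right _ (mem_filter.2 ⟨uncovered_subset g hu.1, hne, hadj⟩)
    · exact mem_union_left _ (mem_filter.2 ⟨hu.1, fun h ↦ hne (congrArg f h), hadj⟩)
  have hcard := (card_le_card hcover).trans (card_union_le _ _)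
  have hone := hb i
  omega

theorem hasMatching_compl_of_card_crossEdges_lt (hcross : #(crossEdges G f W) < t * t)
    (hW : 2 * n + 2 * t ≤ #W) (hne : ∀ x ∈ W, n + 2 * t ≤ #{y ∈ W | f y ≠ f x}) :
    HasMatching Gᶜ W n := by
  classical
  by_contra hnot
  obtain ⟨r, hr, g, hg⟩ := exists_isMaximumMatchingIn hnot
  have hcard := hg.card_uncovered_add
  obtain ⟨x, hx, hxt⟩ := exists_card_uncovered_label_ne_lt hg (by omega) hcross
  have hsplit : #{u ∈ uncovered W g | f u = f x} + #{u ∈ uncovered W g | f u ≠ f x} =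
      #(uncovered W g) := card_filter_add_card_filter_not _
  have havoid := card_matchingEdges_avoiding_lt (c := f x) hg (by omega) hcross
  have hcover : ({y ∈ W | f y ≠ f x} : Finset α) ⊆ {u ∈ uncovered W g | f u ≠ f x} ∪
      image g {p | f (g p) ≠ f x} := by
    intro y hy
    rw [mem_filter] at hy
    by_cases hyg : y ∈ Set.range g
    · obtain ⟨p, rfl⟩ := hyg
      exact mem_union_right _ (mem_image_of_mem g ((mem_filter_univ p).2 hy.2))
    · exact mem_union_left _ (mem_filter.2 ⟨mem_uncovered.2 ⟨hy.1, hyg⟩, hy.2⟩)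
  have hends := card_filter_prod_bool_le fun p ↦ f (g p) ≠ f x
  rw [Fintype.card_fin] at hends
  have hle := (card_le_card hcover).trans
    ((card_union_le _ _).trans (Nat.add_le_add_left card_image_le _))
  have hge := hne x (uncovered_subset g hx)
  omega

theorem fanGraph_isContained_compl_of_card_crossEdges_lt (hS : S.Nonempty)
    (hcross : #(crossEdges G f S) < t * t)
    (hclass : ∀ x ∈ S, 2 * n + 3 * t + #{y ∈ S | f y = f x} ≤ #S)
    (hclasses : ∀ x ∈ S, ∀ z ∈ S, f x ≠ f z →
      n + 3 * t + #{y ∈ S | f y = f x} + #{y ∈ S | f y = f z} ≤ #S) :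
    fanGraph n ⊑ Gᶜ := by
  classical
  obtain ⟨x₀, hx₀⟩ := hS
  obtain ⟨v, hv, hvt⟩ := exists_card_cross_adj_lt (by have := hclass x₀ hx₀; omega) hcross
  let W : Finset α := {y ∈ S | f v ≠ f y ∧ ¬ G.Adj v y}
  have hWS : W ⊆ S := filter_subset _ _
  have hcover : S ⊆ {y ∈ S | f y = f v} ∪ ({y ∈ S | f v ≠ f y ∧ G.Adj v y} ∪ W) := by
    intro y hy
    simp only [W, mem_union, mem_filter, hy, true_and, eq_comm (a := f y)]
    tauto
  have hSW := (card_le_card hcover).trans ((card_union_le _ _).trans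
    (Nat.add_le_add_left (card_union_le _ _) _))
  have hWv (w) (hw : w ∈ W) : Gᶜ.Adj v w := by
    obtain ⟨-, hne, hadj⟩ := mem_filter.1 hw
    exact ⟨fun h ↦ hne (congrArg f h), hadj⟩
  refine fanGraph_isContained_of_hasMatching hWv (hasMatching_compl_of_card_crossEdges_lt (t := t)
    ((card_le_card (crossEdges_mono hWS)).trans_lt hcross) ?_ fun x hx ↦ ?_)
  · have := hclass v hv
    omega
  · have hsplit : #{y ∈ W | f y = f x} + #{y ∈ W | f y ≠ f x} = #W :=
      card_filter_add_card_filter_not _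
    have hle : #{y ∈ W | f y = f x} ≤ #{y ∈ S | f y = f x} :=
      card_le_card (filter_subset_filter _ hWS)
    have := hclasses v hv x (hWS hx) (mem_filter.1 hx).2.1
    omega

end CrossEdges

section Walks

variable {ι : Type*} [DecidableEq ι] {R : SimpleGraph ι} {a b c : ι}

theorem count_tail_support_append (p : R.Walk a b) (q : R.Walk b c) (x : ι) :
    (p.append q).support.tail.count x = p.support.tail.count x + q.support.tail.count x := by
  rw [Walk.tail_support_append, List.count_append]

theorem count_tail_support_le_length (p : R.Walk a b) (x : ι) :
    p.support.tail.count x ≤ p.length :=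
  List.count_le_length.trans (by simp)

theorem count_support_le_count_tail_support_succ (p : R.Walk a b) (x : ι) :
    p.support.count x ≤ p.support.tail.count x + 1 := by
  rw [← Walk.cons_tail_support, List.tail_cons, List.count_cons]
  split_ifs <;> omega

theorem exists_walk_back_and_forth (h : R.Adj a b) (n : ℕ) :
    ∃ p : R.Walk a a, p.length = 2 * n ∧
      ∀ x, p.support.tail.count x = if x = a ∨ x = b then n else 0 := by
  induction n with
  | zero => exact ⟨Walk.nil, by simp⟩
  | succ n ih =>
    obtain ⟨p, hp, hcount⟩ := ih
    refine ⟨Walk.cons h (Walk.cons h.symm p), by simp only [Walk.length_cons]; omega, fun x ↦ ?_⟩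
    have hx := hcount x
    have hab := h.ne
    rw [Walk.support_cons, List.tail_cons, Walk.support_cons, ← Walk.cons_tail_support p,
      List.count_cons, List.count_cons, hx]
    grind

theorem exists_closed_walk_through_edges [Fintype ι] {κ : Type*} {g : κ × Bool → ι}
    (hadj : ∀ i, R.Adj (g (i, false)) (g (i, true)))
    (hreach : ∀ i, R.Reachable a (g (i, false))) (J : Finset κ) :
    ∃ Q ≤ #J * Fintype.card ι, ∀ τ : κ → ℕ, ∃ p : R.Walk a a,
      p.length = 2 * (∑ j ∈ J, τ j + Q) ∧
      ∀ x, p.support.tail.count x ≤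
        2 * Q + ∑ j ∈ J, if x = g (j, false) ∨ x = g (j, true) then τ j else 0 := by
  classical
  induction J using Finset.induction_on with
  | empty => exact ⟨0, by simp, fun _ ↦ ⟨Walk.nil, by simp⟩⟩
  | insert j J hj ih =>
    obtain ⟨Q, hQ, ih⟩ := ih
    obtain ⟨q, hq⟩ := (hreach j).exists_isPath
    have hql := hq.length_lt
    refine ⟨Q + q.length, by rw [card_insert_of_notMem hj, add_mul]; omega, fun τ ↦ ?_⟩
    obtain ⟨p, hp, hpcount⟩ := ih τ
    obtain ⟨l, hl, hlcount⟩ := exists_walk_back_and_forth (hadj j) (τ j)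
    refine ⟨p.append (q.append (l.append q.reverse)), ?_, fun x ↦ ?_⟩
    · simp only [Walk.length_append, Walk.length_reverse, hp, hl, sum_insert hj]
      ring
    · have hpx := hpcount x
      have hqx := count_tail_support_le_length q x
      have hqx' := count_tail_support_le_length q.reverse x
      rw [Walk.length_reverse] at hqx'
      rw [sum_insert hj, count_tail_support_append, count_tail_support_append,
        count_tail_support_append, hlcount]
      omega

theorem exists_sum_eq_of_le_mul {t cap T : ℕ} (h : T ≤ t * cap) :
    ∃ τ : Fin t → ℕ, (∀ i, τ i ≤ cap) ∧ ∑ i, τ i = T := by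
  induction t generalizing T with
  | zero =>
    obtain rfl : T = 0 := by simpa using h
    exact ⟨0, by simp⟩
  | succ t ih =>
    obtain ⟨τ, hτ, hsum⟩ := ih (T := T - min T cap) (by rw [add_mul] at h; omega)
    refine ⟨Fin.cons (min T cap) τ, Fin.cases (by simp) (by simpa using hτ), ?_⟩
    rw [Fin.sum_cons, hsum]
    omega

/-- The walk spends nearly all its time going back and forth along the matching edges. -/
theorem HasMatching.exists_closed_walk [Fintype ι] {W : Finset ι} {t : ℕ} (h : HasMatching R W t)
    (hreach : ∀ x ∈ W, R.Reachable a x) :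
    ∃ Q ≤ t * Fintype.card ι, ∀ cap T, T ≤ t * cap → ∃ p : R.Walk a a,
      p.length = 2 * (T + Q) ∧ ∀ x, p.support.tail.count x ≤ 2 * Q + cap := by
  obtain ⟨g, hg⟩ := h
  obtain ⟨Q, hQ, hwalk⟩ :=
    exists_closed_walk_through_edges (a := a) hg.adj (fun i ↦ hreach _ (hg.mem _)) univ
  rw [card_univ, Fintype.card_fin] at hQ
  refine ⟨Q, hQ, fun cap T hT ↦ ?_⟩
  obtain ⟨τ, hτ, rfl⟩ := exists_sum_eq_of_le_mul hT
  obtain ⟨p, hp, hcount⟩ := hwalk τ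
  refine ⟨p, hp, fun x ↦ (hcount x).trans (Nat.add_le_add_left ?_ _)⟩
  by_cases hx : ∃ i, x = g (i, false) ∨ x = g (i, true)
  · obtain ⟨i, hi⟩ := hx
    rw [sum_eq_single i (fun j _ hji ↦ if_neg fun hj ↦ hji ?_) (by simp), if_pos hi]
    · exact hτ i
    · rcases hi with rfl | rfl <;> rcases hj with hj | hj <;>
        exact (congrArg Prod.fst (hg.injective hj)).symm
  · push Not at hx
    rw [sum_eq_zero fun i _ ↦ if_neg (by simp [hx i])]
    exact Nat.zero_le _

end Walks

/-- Any `s` vertices of `A` include one that is joined to at least the fraction `1 / q` of a given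
set of at least `s` vertices of `B`. This is all that the greedy embedding uses about a dense
regular pair. -/
def IsDensePair {α : Type*} (G : SimpleGraph α) [DecidableRel G.Adj] (s q : ℕ) (A B : Finset α) :
    Prop :=
  ∀ X ⊆ A, ∀ Y ⊆ B, s ≤ #X → s ≤ #Y → ∃ x ∈ X, #Y ≤ q * #{y ∈ Y | G.Adj x y}

section Embedding

variable {α ι : Type*} {G : SimpleGraph α} [DecidableRel G.Adj]
  {R : SimpleGraph ι} {V : ι → Finset α} {s q : ℕ}

theorem IsDensePair.exists_le_card_adj {A B X Y : Finset α} {r : ℕ} (h : IsDensePair G s q A B)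
    (hq : 0 < q) (hX : X ⊆ A) (hY : Y ⊆ B) (hsX : s ≤ #X) (hsr : s ≤ r) (hr : r * q ≤ #Y) :
    ∃ x ∈ X, r ≤ #{y ∈ Y | G.Adj x y} := by
  obtain ⟨x, hx, hxY⟩ := h X hX Y hY hsX (hsr.trans ((Nat.le_mul_of_pos_right r hq).trans hr))
  rw [mul_comm r] at hr
  exact ⟨x, hx, Nat.le_of_mul_le_mul_left (hr.trans hxY) hq⟩

theorem card_sdiff_le_card_sdiff_insert [DecidableEq α] [DecidableEq ι]
    (hV : Pairwise fun a b ↦ Disjoint (V a) (V b)) {a : ι} {x : α} (hx : x ∈ V a) (F : Finset α)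
    (b : ι) : #(V b \ F) ≤ #(V b \ insert x F) + if a = b then 1 else 0 := by
  rw [sdiff_insert]
  split_ifs with hab
  · have := pred_card_le_card_erase (a := x) (s := V b \ F)
    omega
  · rw [erase_eq_of_notMem fun hxb ↦ Finset.disjoint_left.1 (hV hab) hx (mem_sdiff.1 hxb).1,
      add_zero]

/-- The set `F` consists of the vertices that are already used, including the set `S` of admissible
endpoints, which is reserved from the start. -/
theorem exists_isPath_along_walk [DecidableEq α] [DecidableEq ι]
    (hV : Pairwise fun a b ↦ Disjoint (V a) (V b)) (hs : 0 < s)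
    (hq : 0 < q) (hR : ∀ a b, R.Adj a b → IsDensePair G s q (V a) (V b)) {a b : ι}
    (p : R.Walk a b) (hp : ¬p.Nil) {F S X : Finset α} (hSF : S ⊆ F) (hS : S ⊆ V b) (hsS : s ≤ #S)
    (hX : X ⊆ V a \ F) (hsX : s ≤ #X)
    (hroom : ∀ c ∈ p.support, p.support.count c + s * q ≤ #(V c \ F)) :
    ∃ x ∈ X, ∃ y ∈ S, ∃ w : G.Walk x y,
      w.IsPath ∧ w.length = p.length ∧ ∀ z ∈ w.support, z ∈ F → z = y := by
  induction p generalizing F X with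
  | nil => exact absurd Walk.Nil.nil hp
  | @cons a c b hac p ih =>
    cases p with
    | nil =>
      obtain ⟨x, hx, hxS⟩ := hR a c hac X (hX.trans sdiff_subset) S hS hsX hsS
      obtain ⟨y, hy⟩ := card_pos.1 (Nat.pos_of_mul_pos_left ((hs.trans_le hsS).trans_le hxS))
      rw [mem_filter] at hy
      have hxF := (mem_sdiff.1 (hX hx)).2
      exact ⟨x, hx, y, hy.1, Walk.cons hy.2 Walk.nil, by simpa using hy.2.ne, rfl, by simp [hxF]⟩
    | @cons _ d _ hcd p =>
      obtain ⟨x, hx, hxY⟩ := (hR a c hac).exists_le_card_adj hq (hX.trans sdiff_subset)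
        (sdiff_subset (s := V c) (t := F)) hsX le_rfl
        (le_add_self.trans (hroom c (by simp)))
      obtain ⟨hxa, hxF⟩ := mem_sdiff.1 (hX hx)
      have hY : ({y ∈ V c \ F | G.Adj x y} : Finset α) ⊆ V c \ insert x F := fun z hz ↦ by
        rw [mem_filter, mem_sdiff] at hz
        rw [mem_sdiff, mem_insert, not_or]
        exact ⟨hz.1.1, hz.2.ne', hz.1.2⟩
      have hroom' : ∀ e ∈ (Walk.cons hcd p).support,
          (Walk.cons hcd p).support.count e + s * q ≤ #(V e \ insert x F) := fun e he ↦ by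
        have he' := hroom e (List.mem_cons_of_mem _ he)
        have := card_sdiff_le_card_sdiff_insert hV hxa F e
        simp only [Walk.support_cons, List.count_cons, beq_iff_eq] at he' this ⊢
        omega
      obtain ⟨x', hx', y, hy, w, hw, hwlen, hwF⟩ :=
        ih (by simp) (hSF.trans (subset_insert x F)) hS hY hxY hroom'
      have hxw : x ∉ w.support := fun hmem ↦ hxF (hwF x hmem (mem_insert_self _ _) ▸ hSF hy)
      refine ⟨x, hx, y, hy, Walk.cons (mem_filter.1 hx').2 w, hw.cons hxw,
        congrArg (· + 1) hwlen, fun z hz hzF ↦ ?_⟩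
      rcases List.mem_cons.1 hz with rfl | hz
      · exact absurd hzF hxF
      · exact hwF z hz (mem_insert_of_mem hzF)

theorem cycleGraph_isContained_of_closed_walk [DecidableEq ι]
    (hV : Pairwise fun a b ↦ Disjoint (V a) (V b))
    (hs : 0 < s) (hq : 0 < q) (hR : ∀ a b, R.Adj a b → IsDensePair G s q (V a) (V b)) {o a : ι}
    (hoa : R.Adj o a) (p : R.Walk a a) (hp : ¬p.Nil) (ho : s ≤ #(V o)) (ha : 2 * s * q ≤ #(V a))
    (hroom : ∀ c ∈ p.support, p.support.count c + s * q + s + 1 ≤ #(V c)) :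
    cycleGraph (p.length + 2) ⊑ G := by
  classical
  obtain ⟨x₀, hx₀, hnbrs⟩ := (hR o a hoa).exists_le_card_adj hq subset_rfl subset_rfl ho
    (Nat.le_mul_of_pos_left s two_pos) ha
  obtain ⟨S, hS, hsS⟩ := exists_subset_card_eq (Nat.le_of_mul_le_mul_left
    (show 2 * s ≤ 2 * #{y ∈ V a | G.Adj x₀ y} by omega) two_pos)
  have hx₀a : x₀ ∉ V a := Finset.disjoint_left.1 (hV hoa.ne) hx₀
  have hSa : S ⊆ V a := hS.trans (filter_subset _ _)
  have hX : {y ∈ V a | G.Adj x₀ y} \ S ⊆ V a \ insert x₀ S := fun z hz ↦ by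
    rw [mem_sdiff, mem_filter] at hz
    rw [mem_sdiff, mem_insert, not_or]
    exact ⟨hz.1.1, fun h ↦ hx₀a (h ▸ hz.1.1), hz.2⟩
  have hsX : s ≤ #({y ∈ V a | G.Adj x₀ y} \ S) := by
    rw [card_sdiff_of_subset hS]
    omega
  have hroom' : ∀ c ∈ p.support, p.support.count c + s * q ≤ #(V c \ insert x₀ S) := by
    intro c hc
    have := hroom c hc
    have := le_card_sdiff (insert x₀ S) (V c)
    have := card_insert_le x₀ S
    omega
  obtain ⟨x, hx, y, hy, w, hw, hwlen, hwF⟩ :=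
    exists_isPath_along_walk hV hs hq hR p hp (subset_insert x₀ S) hSa hsS.ge hX hsX hroom'
  rw [mem_sdiff, mem_filter] at hx
  have hx₀w : x₀ ∉ w.support := fun hmem ↦ hx₀a (hwF x₀ hmem (mem_insert_self _ _) ▸ hSa hy)
  have hyx₀ : G.Adj y x₀ := (mem_filter.1 (hS hy)).2.symm
  have hlen : 0 < p.length := Walk.not_nil_iff_lt_length.1 hp
  refine (cycleGraph_isContained_iff (by omega)).2 ⟨y, Walk.cons hyx₀ (Walk.cons hx.1.2 w), ?_,
    by simp [hwlen]⟩
  refine (Walk.cons_isCycle_iff _ _).2 ⟨hw.cons hx₀w, fun hmem ↦ ?_⟩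
  rcases List.mem_cons.1 hmem with heq | hmem
  · have hyx : y = x := by simpa [hyx₀.ne] using heq
    exact hx.2 (hyx ▸ hy)
  · exact hx₀w (w.snd_mem_support_of_mem_edges hmem)

theorem cycleGraph_isContained_of_reachable [Fintype ι]
    (hV : Pairwise fun a b ↦ Disjoint (V a) (V b)) (hs : 0 < s) (hq : 0 < q)
    (hR : ∀ a b, R.Adj a b → IsDensePair G s q (V a) (V b)) [DecidableRel R.Adj] {W : Finset ι}
    {t cap m : ℕ} (ht : 0 < t) (hW : 2 * t ≤ #W) (hdeg : ∀ u ∈ W, t ≤ #{v ∈ W | R.Adj u v})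
    (hreach : ∀ u ∈ W, ∀ v ∈ W, R.Reachable u v) (hm : t * Fintype.card ι < m)
    (hmt : m ≤ t * cap)
    (hroom : ∀ a, 2 * (t * Fintype.card ι) + cap + 2 * s * q + s + 2 ≤ #(V a)) :
    cycleGraph (2 * m) ⊑ G := by
  classical
  obtain ⟨o, ho⟩ := card_pos.1 (show 0 < #W by omega)
  obtain ⟨a, ha⟩ := card_pos.1 (ht.trans_le (hdeg o ho))
  rw [mem_filter] at ha
  obtain ⟨Q, hQ, hwalk⟩ := (hasMatching_of_le_card_adj hW hdeg).exists_closed_walk (hreach a ha.1)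
  obtain ⟨p, hp, hcount⟩ := hwalk cap (m - 1 - Q) (by omega)
  have hsq : s * q ≤ 2 * s * q := Nat.mul_le_mul_right q (by omega)
  have hm2 : 2 ≤ m := by
    have := card_pos.2 (univ_nonempty_iff.2 ⟨o⟩)
    have := Nat.mul_pos ht this
    rw [card_univ] at this
    omega
  have hcycle := cycleGraph_isContained_of_closed_walk hV hs hq hR ha.2 p ?_ ?_ ?_ fun c _ ↦ ?_
  · rwa [hp, show 2 * (m - 1 - Q + Q) + 2 = 2 * m by omega] at hcycle
  · rw [Walk.not_nil_iff_lt_length]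
    omega
  · exact le_trans (by omega) (hroom o)
  · exact le_trans (by omega) (hroom a)
  · have h₁ := count_support_le_count_tail_support_succ p c
    have h₂ := hcount c
    have h₃ := hroom c
    omega

end Embedding

section Regularity

variable {α : Type*} {G : SimpleGraph α} [DecidableRel G.Adj]

theorem card_interedges_eq_edgeDensity_mul (A B : Finset α) :
    (#(G.interedges A B) : ℝ) = G.edgeDensity A B * (#A * #B) := by
  rcases A.eq_empty_or_nonempty with rfl | hA
  · simp
  rcases B.eq_empty_or_nonempty with rfl | hB
  · simp [interedges_def]
  have hA' : (#A : ℝ) ≠ 0 := by simpa using hA.ne_empty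
  have hB' : (#B : ℝ) ≠ 0 := by simpa using hB.ne_empty
  rw [edgeDensity_def]
  push_cast
  field_simp

theorem isDensePair_of_isUniform {ε δ : ℝ} {A B : Finset α} {s q : ℕ} (hAB : G.IsUniform ε A B)
    (hδ : δ ≤ G.edgeDensity A B) (hq : 1 ≤ q * (δ - ε)) (hs : 0 < s) (hA : #A * ε ≤ s)
    (hB : #B * ε ≤ s) : IsDensePair G s q A B := by
  intro X hXA Y hYB hX hY
  by_contra! hdeg
  have hX0 : X.Nonempty := card_pos.1 (hs.trans_le hX)
  have hdensity : δ - ε < G.edgeDensity X Y := by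
    have := (abs_lt.1 (hAB hXA hYB (hA.trans (mod_cast hX)) (hB.trans (mod_cast hY)))).1
    linarith
  have hedges : (q * #(G.interedges X Y) : ℝ) < #X * #Y := by
    have := sum_lt_sum_of_nonempty hX0 hdeg
    rw [← mul_sum, sum_const, smul_eq_mul, ← card_interedges_eq_sum] at this
    exact_mod_cast this
  rw [card_interedges_eq_edgeDensity_mul] at hedges
  have : (1 : ℝ) * (#X * #Y) ≤ q * G.edgeDensity X Y * (#X * #Y) := by
    gcongr
    exact hq.trans (by gcongr)
  linarith

variable [DecidableEq α] [Fintype α] {P : Finpartition (univ : Finset α)} {ε δ : ℝ}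

theorem interedges_not_regularityReduced_subset :
    Rel.interedges (fun x y ↦ G.Adj x y ∧ ¬(G.regularityReduced P ε δ).Adj x y) univ univ ⊆
      (P.nonUniforms G ε).biUnion (fun (A, B) ↦ A ×ˢ B) ∪ P.parts.biUnion offDiag ∪
        (P.sparsePairs G δ).biUnion fun (A, B) ↦ G.interedges A B := by
  rintro ⟨x, y⟩ hxy
  obtain ⟨-, -, hadj, hred⟩ := Rel.mk_mem_interedges_iff.1 hxy
  simp only [mem_union, mem_biUnion, Prod.exists, mem_product, mem_offDiag,
    P.mk_mem_nonUniforms, Finpartition.mk_mem_sparsePairs, mk_mem_interedges_iff]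
  have hx := P.mem_part (mem_univ x)
  have hy := P.mem_part (mem_univ y)
  have hPx := P.part_mem.2 (mem_univ x)
  have hPy := P.part_mem.2 (mem_univ y)
  by_cases hne : P.part x = P.part y
  · exact .inl (.inr ⟨_, hPx, hx, hne ▸ hy, hadj.ne⟩)
  by_cases hunif : G.IsUniform ε (P.part x) (P.part y)
  · refine .inr ⟨_, _, ⟨hPx, hPy, hne, ?_⟩, hx, hy, hadj⟩
    by_contra! hdense
    exact hred ⟨hadj, _, hPx, _, hPy, hx, hy, hne, hunif, hdense⟩
  · exact .inl (.inl ⟨_, _, ⟨hPx, hPy, hne, hunif⟩, hx, hy⟩)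

theorem card_interedges_not_regularityReduced_le [Nonempty α] (hε : 0 < ε) (hεδ : ε ≤ δ)
    (hP : P.IsEquipartition) (hPG : P.IsUniform G ε) (hparts : 4 / δ ≤ #P.parts) :
    (#(Rel.interedges (fun x y ↦ G.Adj x y ∧ ¬(G.regularityReduced P ε δ).Adj x y) univ univ) : ℝ)
      ≤ 9 * δ * Fintype.card α ^ 2 := by
  have hδ : 0 < δ := hε.trans_le hεδ
  have hunif := hP.sum_nonUniforms_lt univ_nonempty hε hPG
  have hdiag := hP.card_biUnion_offDiag_le hδ hparts
  have hsparse := hP.card_interedges_sparsePairs_le (G := G) hδ.le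
  have hcard := (card_le_card (interedges_not_regularityReduced_subset (G := G) (P := P)
    (ε := ε) (δ := δ))).trans
      ((card_union_le _ _).trans (Nat.add_le_add_right (card_union_le _ _) _))
  rw [← Nat.cast_le (α := ℝ)] at hcard
  push_cast at hcard
  rw [card_univ] at hunif hdiag hsparse
  have : ε * (Fintype.card α : ℝ) ^ 2 ≤ δ * Fintype.card α ^ 2 := by gcongr
  linarith [sq_nonneg (Fintype.card α : ℝ), mul_nonneg hδ.le (sq_nonneg (Fintype.card α : ℝ))]

end Regularity

section Clusters

variable {α : Type*} [Fintype α] [DecidableEq α] (G : SimpleGraph α) [DecidableRel G.Adj]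
  (P : Finpartition (univ : Finset α)) (ε δ : ℝ)

/-- The cluster graph of `G`: its vertices are the parts of `P`, and two parts are adjacent when
they form an `ε`-uniform pair of density at least `δ`. -/
def clusterGraph : SimpleGraph P.parts where
  Adj U V := U ≠ V ∧ G.IsUniform ε U.1 V ∧ δ ≤ G.edgeDensity U.1 V
  symm.symm _ _ h := ⟨h.1.symm, h.2.1.symm, by rw [edgeDensity_comm]; exact h.2.2⟩
  loopless.irrefl _ h := h.1 rfl

/-- The part of `P` containing `x`, as a vertex of the cluster graph. -/
def cluster (x : α) : P.parts := ⟨P.part x, P.part_mem.2 (mem_univ x)⟩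

/-- The connected component, in the cluster graph, of the part containing `x`. -/
def clusterComponent (x : α) : (clusterGraph G P ε δ).ConnectedComponent :=
  (clusterGraph G P ε δ).connectedComponentMk (cluster P x)

variable {G P ε δ}

theorem clusterGraph_adj_of_regularityReduced_adj {x y : α}
    (h : (G.regularityReduced P ε δ).Adj x y) :
    (clusterGraph G P ε δ).Adj (cluster P x) (cluster P y) := by
  obtain ⟨-, U, hU, V, hV, hx, hy, hne, hunif, hdense⟩ := h
  obtain rfl := P.part_eq_of_mem hU hx
  obtain rfl := P.part_eq_of_mem hV hy
  exact ⟨fun h ↦ hne (congrArg Subtype.val h), hunif, hdense⟩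

theorem clusterComponent_eq_of_regularityReduced_adj {x y : α}
    (h : (G.regularityReduced P ε δ).Adj x y) :
    clusterComponent G P ε δ y = clusterComponent G P ε δ x :=
  ConnectedComponent.sound (clusterGraph_adj_of_regularityReduced_adj h).symm.reachable

theorem card_le_mul_card_image_cluster {w : ℕ} (hw : ∀ U ∈ P.parts, #U ≤ w) (T : Finset α) :
    #T ≤ w * #(T.image (cluster P)) := by
  refine card_le_mul_card_image T w fun U _ ↦ (card_le_card fun x hx ↦ ?_).trans (hw U U.2)
  obtain ⟨-, rfl⟩ := mem_filter.1 hx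
  exact P.mem_part (mem_univ x)

theorem crossEdges_clusterComponent_subset [DecidableEq (clusterGraph G P ε δ).ConnectedComponent]
    (S : Finset α) : crossEdges G (clusterComponent G P ε δ) S ⊆
      Rel.interedges (fun x y ↦ G.Adj x y ∧ ¬(G.regularityReduced P ε δ).Adj x y) univ univ := by
  intro p hp
  obtain ⟨-, hne, hadj⟩ := mem_filter.1 hp
  exact Rel.mem_interedges_iff.2 ⟨mem_univ _, mem_univ _, hadj,
    fun h ↦ hne (clusterComponent_eq_of_regularityReduced_adj h).symm⟩

theorem cycleGraph_isContained_of_clusterComponent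
    [DecidableEq (clusterGraph G P ε δ).ConnectedComponent] {S : Finset α} {w s q t cap m : ℕ}
    (hq : 1 ≤ q * (δ - ε)) (hs : 0 < s) (ht : 0 < t) (hsε : ∀ U ∈ P.parts, #U * ε ≤ s)
    (hw0 : 0 < w) (hw : ∀ U ∈ P.parts, #U ≤ w)
    (hdeg : ∀ x ∈ S, t * w ≤ #{y ∈ S | (G.regularityReduced P ε δ).Adj x y})
    {c : (clusterGraph G P ε δ).ConnectedComponent}
    (hc : 2 * t * w ≤ #{y ∈ S | clusterComponent G P ε δ y = c})
    (hm : t * #P.parts < m) (hmt : m ≤ t * cap)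
    (hroom : ∀ U ∈ P.parts, 2 * (t * #P.parts) + cap + 2 * s * q + s + 2 ≤ #U) :
    cycleGraph (2 * m) ⊑ G := by
  classical
  have hq0 : 0 < q := Nat.pos_of_ne_zero fun h ↦ by norm_num [h] at hq
  rw [← Fintype.card_coe] at hm hroom
  refine cycleGraph_isContained_of_reachable (R := clusterGraph G P ε δ) (V := fun U ↦ U.1)
    (W := {y ∈ S | clusterComponent G P ε δ y = c}.image (cluster P)) (fun U V h ↦ ?_) hs hq0
    (fun U V h ↦ ?_) ht ?_ ?_ ?_ hm hmt fun U ↦ hroom U U.2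
  · exact P.disjoint U.2 V.2 (Subtype.coe_ne_coe.2 h)
  · exact isDensePair_of_isUniform h.2.1 h.2.2 hq hs (hsε _ U.2) (hsε _ V.2)
  · have := hc.trans (card_le_mul_card_image_cluster hw _)
    rw [mul_comm] at this
    exact Nat.le_of_mul_le_mul_left this hw0
  · simp only [forall_mem_image]
    intro x hx
    have := (hdeg x (mem_filter.1 hx).1).trans (card_le_mul_card_image_cluster hw _)
    rw [mul_comm] at this
    refine (Nat.le_of_mul_le_mul_left this hw0).trans (card_le_card fun U hU ↦ ?_)
    obtain ⟨y, hy, rfl⟩ := mem_image.1 hU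
    rw [mem_filter] at hx hy
    exact mem_filter.2 ⟨mem_image_of_mem _ (mem_filter.2
      ⟨hy.1, (clusterComponent_eq_of_regularityReduced_adj hy.2).trans hx.2⟩),
      clusterGraph_adj_of_regularityReduced_adj hy.2⟩
  · simp only [forall_mem_image]
    intro x hx y hy
    exact ConnectedComponent.exact ((mem_filter.1 hx).2.trans (mem_filter.1 hy).2.symm)

theorem degree_le_card_regularityReduced_add (S : Finset α) (x : α) :
    G.degree x ≤ #{y ∈ S | (G.regularityReduced P ε δ).Adj x y} +
      #{y | G.Adj x y ∧ ¬(G.regularityReduced P ε δ).Adj x y} + #Sᶜ := by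
  rw [← card_neighborFinset_eq_degree]
  refine (card_le_card fun y hy ↦ ?_).trans
    ((card_union_le _ _).trans (Nat.add_le_add_right (card_union_le _ _) _))
  rw [mem_neighborFinset] at hy
  simp only [mem_union, mem_filter, mem_univ, true_and, mem_compl]
  tauto

end Clusters

section Parameters

theorem exists_embedding_parameters {k w q m N : ℕ} (hq : 8 ≤ q) (hk : 2 * q ≤ k)
    (hw : 8 * q * (k ^ 2 + 4 * q ^ 2 + 4) ≤ w) (hkw : k * w ≤ N) (hmN : m ≤ N) :
    ∃ s t cap, 0 < s ∧ 0 < t ∧ w + 1 ≤ s * q ^ 4 ∧ m ≤ t * cap ∧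
      k ^ 2 + cap + 2 * s * (2 * q ^ 2) + s + 2 ≤ w ∧
      t * (w + 1) * q ≤ m * q + 3 * N := by
  have hs : w / q ^ 4 * q ^ 4 ≤ w := Nat.div_mul_le_self _ _
  have hs' : w < (w / q ^ 4 + 1) * q ^ 4 := Nat.lt_mul_of_div_lt (by omega) (by positivity)
  generalize w / q ^ 4 = s at hs hs'
  have hroom : q * (k ^ 2 + 2 * (s + 1) * (2 * q ^ 2) + (s + 1) + 3) ≤ w := by
    have h₁ : 8 * (q ^ 3 * s) ≤ q * (q ^ 3 * s) := Nat.mul_le_mul_right _ hq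
    have h₂ : 1 * (q * s) ≤ q ^ 2 * (q * s) := by gcongr; exact Nat.one_le_pow _ _ (by omega)
    linarith
  obtain ⟨cap, hcap⟩ : ∃ cap, w = k ^ 2 + 2 * (s + 1) * (2 * q ^ 2) + (s + 1) + 3 + cap :=
    Nat.exists_eq_add_of_le ((Nat.le_mul_of_pos_left _ (by omega)).trans hroom)
  have hcap' : q * w ≤ q * cap + w := by
    exact (congrArg (q * ·) hcap).trans_le (by linarith)
  have hcap0 : 0 < cap := by
    by_contra! h
    nlinarith [hcap']
  have ht : m < (m / cap + 1) * cap := Nat.lt_mul_of_div_lt (Nat.lt_succ_self _) hcap0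
  refine ⟨s + 1, m / cap + 1, cap, Nat.succ_pos _, Nat.succ_pos _, hs', ht.le, by omega, ?_⟩
  have h₁ : q * (w + 1) ≤ (q + 2) * cap := by
    nlinarith [hcap']
  calc (m / cap + 1) * (w + 1) * q = m / cap * (q * (w + 1)) + q * (w + 1) := by ring
    _ ≤ m / cap * ((q + 2) * cap) + q * (w + 1) := by gcongr
    _ = (q + 2) * (m / cap * cap) + q * (w + 1) := by ring
    _ ≤ (q + 2) * m + q * (w + 1) := by gcongr; exact Nat.div_mul_le_self _ _
    _ ≤ (q + 2) * m + k * w := by nlinarith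
    _ ≤ m * q + 3 * N := by linarith

end Parameters

section Partition

theorem exists_card_compl_le_and_card_filter_le {α β : Type*} [Fintype α] [DecidableEq α]
    [Fintype β] {r : α → β → Prop} [∀ x, DecidablePred (r x)] {a b : ℝ} (hb : 0 < b)
    (h : (#(Rel.interedges r univ univ) : ℝ) ≤ a * b) :
    ∃ S : Finset α, (#Sᶜ : ℝ) ≤ a ∧ ∀ x ∈ S, (#{y | r x y} : ℝ) ≤ b := by
  refine ⟨univ.filter fun x ↦ (#{y | r x y} : ℝ) ≤ b, le_of_mul_le_mul_right (le_trans ?_ h) hb,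
    fun x hx ↦ (mem_filter.1 hx).2⟩
  rw [card_interedges_eq_sum, compl_filter]
  push_cast
  calc #{x | ¬(#{y | r x y} : ℝ) ≤ b} * b
      ≤ ∑ x with ¬(#{y | r x y} : ℝ) ≤ b, (#{y | r x y} : ℝ) := by
        rw [← nsmul_eq_mul]
        exact card_nsmul_le_sum _ _ _ fun x hx ↦ (not_le.1 (mem_filter.1 hx).2).le
    _ ≤ ∑ x, (#{y | r x y} : ℝ) :=
        sum_le_sum_of_subset_of_nonneg (filter_subset _ _) fun _ _ _ ↦ Nat.cast_nonneg _

universe u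

variable {α : Type u} [Fintype α] [DecidableEq α] {G : SimpleGraph α} [DecidableRel G.Adj]
  {P : Finpartition (univ : Finset α)}

theorem card_clusterComponent_le {q m : ℕ} (hq : 8 ≤ q) (hP : P.IsEquipartition)
    (hk : 4 * q ^ 2 ≤ #P.parts)
    (hm : #P.parts * (8 * q * (#P.parts ^ 2 + 4 * q ^ 2 + 4)) ≤ m)
    (hmN : m ≤ Fintype.card α) (hcycle : ¬cycleGraph (2 * m) ⊑ G) {S : Finset α}
    [DecidableEq (clusterGraph G P (1 / q ^ 4) (1 / q ^ 2)).ConnectedComponent]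
    (hdeg : ∀ x ∈ S, m + 3 * Fintype.card α / q ≤
      (#{y ∈ S | (G.regularityReduced P (1 / q ^ 4 : ℝ) (1 / q ^ 2)).Adj x y} : ℝ))
    (c : (clusterGraph G P (1 / q ^ 4) (1 / q ^ 2)).ConnectedComponent) :
    (#{y ∈ S | clusterComponent G P (1 / q ^ 4) (1 / q ^ 2) y = c} : ℝ) ≤
      2 * m + 6 * Fintype.card α / q := by
  set k := #P.parts
  set w := Fintype.card α / k
  have hk0 : 0 < k := by nlinarith
  have hwup : ∀ U ∈ P.parts, #U ≤ w + 1 := fun U hU ↦ hP.card_part_le_average_add_one hU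
  have hw : 8 * q * (k ^ 2 + 4 * q ^ 2 + 4) ≤ w :=
    (Nat.le_div_iff_mul_le hk0).2 ((mul_comm _ _).trans_le (hm.trans hmN))
  obtain ⟨s, t, cap, hs, ht, hsw, hmt, hroom, htw⟩ :=
    exists_embedding_parameters (m := m) hq (by nlinarith) hw (Nat.mul_div_le _ _) hmN
  have hq0 : (0 : ℝ) < q := by positivity
  have htw' : (t * (w + 1 : ℕ) : ℝ) ≤ m + 3 * Fintype.card α / q := by
    field_simp
    exact_mod_cast htw
  by_contra! hlt
  have hclass : 2 * t * (w + 1) ≤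
      #{y ∈ S | clusterComponent G P (1 / q ^ 4) (1 / q ^ 2) y = c} := by
    rify
    push_cast at htw'
    linear_combination 2 * htw' + hlt
  have htk : 2 * t ≤ k := by
    have : Fintype.card α < k * (w + 1) := Nat.lt_mul_div_succ _ hk0
    exact (lt_of_mul_lt_mul_right ((hclass.trans (card_le_univ _)).trans_lt this)
      (Nat.zero_le _)).le
  refine hcycle (cycleGraph_isContained_of_clusterComponent (q := 2 * q ^ 2) (w := w + 1) ?_ hs ht
    (fun U hU ↦ ?_) (Nat.succ_pos _) hwup (fun x hx ↦ ?_) hclass ?_ hmt fun U hU ↦ ?_)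
  · have : (2 : ℝ) ≤ q ^ 2 := by norm_cast; nlinarith
    push_cast
    field_simp
    linarith
  · rw [mul_one_div, div_le_iff₀ (by positivity)]
    exact_mod_cast (hwup U hU).trans hsw
  · exact_mod_cast htw'.trans (hdeg x hx)
  · have : k < 8 * q * (k ^ 2 + 4 * q ^ 2 + 4) := by nlinarith
    calc t * k ≤ k * k := by gcongr; omega
      _ < k * (8 * q * (k ^ 2 + 4 * q ^ 2 + 4)) := by gcongr
      _ ≤ m := hm
  · have : w ≤ #U := hP.average_le_card_part hU
    nlinarith

theorem exists_partition_of_isUniform [Nonempty α] {q m : ℕ} {ε : ℝ} (hq : 8 ≤ q)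
    (hP : P.IsEquipartition) (hPG : P.IsUniform G (1 / q ^ 4 : ℝ)) (hk : 4 * q ^ 2 ≤ #P.parts)
    (hm : #P.parts * (8 * q * (#P.parts ^ 2 + 4 * q ^ 2 + 4)) ≤ m) (hmN : m ≤ Fintype.card α)
    (hcycle : ¬cycleGraph (2 * m) ⊑ G) (hε : 13 / q ≤ ε)
    (hdeg : ∀ x, m + ε * Fintype.card α ≤ (G.degree x : ℝ)) :
    ∃ (κ : Type u) (_ : DecidableEq κ) (f : α → κ) (S : Finset α),
      (#Sᶜ : ℝ) ≤ 9 * Fintype.card α / q ∧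
      (#(crossEdges G f S) : ℝ) ≤ 9 * Fintype.card α ^ 2 / q ^ 2 ∧
      ∀ x ∈ S, m + (ε - 10 / q) * Fintype.card α ≤ (#{y ∈ S | f y = f x} : ℝ) ∧
        (#{y ∈ S | f y = f x} : ℝ) ≤ 2 * m + 6 * Fintype.card α / q := by
  classical
  have hq1 : (1 : ℝ) ≤ q := mod_cast (by omega : 1 ≤ q)
  have hlost := card_interedges_not_regularityReduced_le (G := G) (P := P) (ε := 1 / q ^ 4)
    (δ := 1 / q ^ 2) (by positivity) (by gcongr; norm_num) hP hPG
    (by rw [div_div_eq_mul_div, div_one]; exact_mod_cast hk)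
  obtain ⟨S, hS, hloss⟩ := exists_card_compl_le_and_card_filter_le (a := 9 * Fintype.card α / q)
    (b := Fintype.card α / q) (by positivity) (hlost.trans_eq (by ring))
  have hred : ∀ x ∈ S, m + (ε - 10 / q) * Fintype.card α ≤
      (#{y ∈ S | (G.regularityReduced P (1 / q ^ 4 : ℝ) (1 / q ^ 2)).Adj x y} : ℝ) := by
    intro x hx
    have := degree_le_card_regularityReduced_add (G := G) (P := P) (ε := 1 / q ^ 4)
      (δ := 1 / q ^ 2) S x
    rify at this
    linear_combination hdeg x + this + hS + hloss x hx
  refine ⟨_, inferInstance, clusterComponent G P (1 / q ^ 4) (1 / q ^ 2), S, hS,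
    ((Nat.cast_le.2 (card_le_card (crossEdges_clusterComponent_subset S))).trans
      hlost).trans_eq (by ring), fun x hx ↦ ⟨(hred x hx).trans ?_, ?_⟩⟩
  · gcongr with y
    exact clusterComponent_eq_of_regularityReduced_adj
  · refine card_clusterComponent_le hq hP hk hm hmN hcycle (fun x hx ↦ (hred x hx).trans' ?_) _
    have := mul_le_mul_of_nonneg_right hε (Nat.cast_nonneg (α := ℝ) (Fintype.card α))
    linear_combination this

theorem exists_partition_of_not_cycleGraph_isContained {δ : ℝ} (hδ : 0 < δ) :
    ∃ m₀ : ℕ, ∀ m ≥ m₀, ∀ {α : Type u} [Fintype α] [DecidableEq α] [Nonempty α]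
      (G : SimpleGraph α) [DecidableRel G.Adj] (ε : ℝ), δ ≤ ε →
      (∀ x, m + ε * Fintype.card α ≤ (G.degree x : ℝ)) → ¬cycleGraph (2 * m) ⊑ G →
      ∃ (κ : Type u) (_ : DecidableEq κ) (f : α → κ) (S : Finset α),
        (#Sᶜ : ℝ) ≤ δ * Fintype.card α ∧
        (#(crossEdges G f S) : ℝ) ≤ δ * Fintype.card α ^ 2 ∧
        ∀ x ∈ S, m + (ε - δ) * Fintype.card α ≤ (#{y ∈ S | f y = f x} : ℝ) ∧
          (#{y ∈ S | f y = f x} : ℝ) ≤ 2 * m + δ * Fintype.card α := by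
  classical
  obtain ⟨q, hq⟩ := exists_nat_ge (max 8 (13 / δ))
  have hq8 : 8 ≤ q := by exact_mod_cast (le_max_left _ _).trans hq
  have hqδ : 13 / q ≤ δ := by
    rw [div_le_comm₀ (by positivity) hδ]
    exact (le_max_right _ _).trans hq
  set K := SzemerediRegularity.bound (1 / q ^ 4 : ℝ) (4 * q ^ 2)
  refine ⟨K * (8 * q * (K ^ 2 + 4 * q ^ 2 + 4)), fun m hm α _ _ _ G _ ε hε hdeg hcycle ↦ ?_⟩
  set N := Fintype.card α
  have hmN : m ≤ N := by
    obtain ⟨x⟩ := ‹Nonempty α›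
    have : (G.degree x : ℝ) < N := mod_cast G.degree_lt_card_verts x
    rify
    linarith [hdeg x, mul_nonneg (hδ.le.trans hε) (Nat.cast_nonneg (α := ℝ) N)]
  have hl : 4 * q ^ 2 ≤ K := SzemerediRegularity.le_bound _ _
  obtain ⟨P, hP, hlk, hkK, hPG⟩ := szemeredi_regularity G (ε := 1 / q ^ 4) (by positivity)
    ((hl.trans (Nat.le_mul_of_pos_right _ (by positivity))).trans (hm.trans hmN))
  obtain ⟨κ, _, f, S, hS, hcross, hclass⟩ := exists_partition_of_isUniform hq8 hP hPG hlk
    (hm.trans' (by gcongr)) hmN hcycle (hqδ.trans hε) hdeg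
  have hNq : 13 * N / q ≤ δ * N := by
    rw [← div_mul_eq_mul_div]
    gcongr
  have hNq0 : (0 : ℝ) ≤ N / q := by positivity
  refine ⟨κ, _, f, S, ?_, hcross.trans ?_,
    fun x hx ↦ ⟨(hclass x hx).1.trans' ?_, (hclass x hx).2.trans ?_⟩⟩
  · linear_combination hS + hNq + 4 * hNq0
  · rw [← div_mul_eq_mul_div]
    gcongr
    refine hqδ.trans' (div_le_div₀ (by norm_num) (by norm_num) (by positivity) ?_)
    exact_mod_cast Nat.le_self_pow two_ne_zero q
  · linear_combination hNq + 3 * hNq0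
  · linear_combination hNq + 7 * hNq0

end Partition

section UpperBound

theorem card_le_degree_add {α : Type*} [Fintype α] {G : SimpleGraph α} [DecidableRel G.Adj]
    {m n : ℕ} (hm : 2 ≤ m) (hmn : m ≤ n) (hcycle : ¬cycleGraph (2 * m) ⊑ G)
    (hfan : ¬fanGraph n ⊑ Gᶜ) (x : α) : Fintype.card α ≤ G.degree x + (2 * n + m + 1) := by
  classical
  have hblue : Gᶜ.degree x ≤ 2 * n + m := by
    by_contra! hlt
    rw [← card_neighborFinset_eq_degree] at hlt
    exact (hasMatching_compl_or_cycleGraph_isContained hm hmn hlt).elim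
      (fun h ↦ hfan (fanGraph_isContained_of_hasMatching (fun w ↦ (mem_neighborFinset ..).1) h))
      hcycle
  rw [degree_compl] at hblue
  omega

theorem exists_card_filter_add_le {α κ : Type*} [DecidableEq κ] {f : α → κ} {S : Finset α}
    {a b : κ} (hab : a ≠ b) (h : #{y ∈ S | f y = a} + #{y ∈ S | f y = b} < #S) :
    ∃ x ∈ S, #{y ∈ S | f y = a} + #{y ∈ S | f y = b} + #{y ∈ S | f y = f x} ≤ #S := by
  classical
  have hdisj : Disjoint {y ∈ S | f y = a} {y ∈ S | f y = b} :=
    disjoint_filter.2 fun y _ ha hb ↦ hab (ha.symm.trans hb)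
  rw [← card_union_of_disjoint hdisj, ← filter_or] at h ⊢
  obtain ⟨x, hx, hxab⟩ := exists_mem_notMem_of_card_lt_card h
  refine ⟨x, hx, ?_⟩
  rw [← card_union_of_disjoint]
  · exact card_le_card (union_subset (filter_subset _ _) (filter_subset _ _))
  · refine disjoint_filter.2 fun y _ hy hyx ↦ hxab (mem_filter.2 ⟨hx, ?_⟩)
    rwa [← hyx]

theorem fanGraph_isContained_compl_of_partition {α κ : Type*} [Fintype α] [DecidableEq α]
    [DecidableEq κ] {G : SimpleGraph α} [DecidableRel G.Adj] {f : α → κ} {S : Finset α}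
    {m n : ℕ} {η : ℝ} (hη : 1 ≤ η * Fintype.card α) (hmn : m = n ∨ 2 * m ≤ n)
    (hcard : 2 * n + 2 * m + 10 * (η * Fintype.card α) ≤ Fintype.card α)
    (hS : (#Sᶜ : ℝ) ≤ η * Fintype.card α)
    (hcross : (#(crossEdges G f S) : ℝ) ≤ (η * Fintype.card α) ^ 2)
    (hlower : ∀ x ∈ S, m + 6 * (η * Fintype.card α) ≤ (#{y ∈ S | f y = f x} : ℝ))
    (hupper : ∀ x ∈ S, (#{y ∈ S | f y = f x} : ℝ) ≤ 2 * m + η * Fintype.card α) :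
    fanGraph n ⊑ Gᶜ := by
  set h : ℝ := η * Fintype.card α
  have hSc : (#Sᶜ : ℝ) + #S = Fintype.card α := by exact_mod_cast card_compl_add_card S
  have ht : (⌊h⌋₊ : ℝ) ≤ h := Nat.floor_le (by linarith)
  have hSpos : (0 : ℝ) < #S := by linarith [Nat.cast_nonneg (α := ℝ) n, Nat.cast_nonneg (α := ℝ) m]
  refine fanGraph_isContained_compl_of_card_crossEdges_lt (f := f) (t := ⌊h⌋₊ + 1)
    (card_pos.1 (by exact_mod_cast hSpos)) ?_ (fun x hx ↦ ?_) fun x hx z hz hxz ↦ ?_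
  · rify
    nlinarith [Nat.lt_floor_add_one h]
  · rify
    linarith [hupper x hx]
  obtain rfl | hmn := hmn
  · have hlt : #{y ∈ S | f y = f x} + #{y ∈ S | f y = f z} < #S := by
      rify
      linarith [hupper x hx, hupper z hz]
    obtain ⟨w, hw, hle⟩ := exists_card_filter_add_le hxz hlt
    rify at hle ⊢
    linarith [hlower w hw]
  · rify at hmn ⊢
    linarith [hupper x hx, hupper z hz]

theorem ramseyArrows_cycleGraph_fanGraph {ε : ℝ} (hε : 0 < ε) :
    ∃ m₀, ∀ m ≥ m₀, ∀ n N : ℕ, (m = n ∨ 2 * m ≤ n) → 2 * n + 2 * m + ε * N ≤ N →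
      RamseyArrows (cycleGraph (2 * m)) (fanGraph n) N := by
  classical
  set η := min 1 (ε / 20)
  have hη0 : 0 < η := by positivity
  have hη1 : η ^ 2 ≤ η := pow_le_of_le_one hη0.le (min_le_left ..) two_ne_zero
  have hηε : 20 * η ≤ ε := by linarith [min_le_right 1 (ε / 20)]
  obtain ⟨m₁, hm₁⟩ := exists_partition_of_not_cycleGraph_isContained.{0} (pow_pos hη0 2)
  obtain ⟨m₂, hm₂⟩ := exists_nat_ge (1 / η)
  refine ⟨m₁ + m₂ + 2, fun m hm n N hmn hN ↦
    ramseyArrows_iff.2 fun G ↦ or_iff_not_imp_left.2 fun hcycle ↦ ?_⟩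
  by_contra hfan
  have hmN : (m : ℝ) ≤ N := by
    have : 0 ≤ 2 * (n : ℝ) + m + ε * N := by positivity
    linarith
  have hηN : 1 ≤ η * N := by
    rw [← div_le_iff₀' hη0]
    exact hm₂.trans ((Nat.cast_le.2 (by omega)).trans hmN)
  have hεN : 20 * (η * N) ≤ ε * N := by nlinarith
  have : Nonempty (Fin N) := ⟨0, by have := Nat.cast_le.1 hmN; omega⟩
  have hdeg (x : Fin N) : m + 8 * η * Fintype.card (Fin N) ≤ (G.degree x : ℝ) := by
    have hx := card_le_degree_add (by omega) (by omega) hcycle hfan x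
    rw [Fintype.card_fin] at hx ⊢
    rify at hx
    linarith
  obtain ⟨κ, _, f, S, hS, hcross, hclass⟩ :=
    hm₁ m (by omega) G (8 * η) (by linarith) hdeg hcycle
  simp only [Fintype.card_fin] at hS hcross hclass
  have hηN' : η ^ 2 * N ≤ η * N := by gcongr
  refine hfan (fanGraph_isContained_compl_of_partition (η := η) (f := f) (S := S) ?_ hmn ?_ ?_ ?_
    (fun x hx ↦ ?_) fun x hx ↦ ?_) <;> simp only [Fintype.card_fin]
  · exact hηN
  · linarith
  · linarith
  · rwa [mul_pow]
  · linarith [hclass x hx]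
  · linarith [(hclass x hx).2]

end UpperBound

section Asymptotics

open Asymptotics Filter Topology

theorem exists_tendsto_zero_eq_add_mul {ι : Type*} {l : Filter ι} {s : Set ι} {a b : ι → ℝ} {c : ℝ}
    (h : (fun i ↦ a i - c * b i) =o[l ⊓ 𝓟 s] b) :
    ∃ ε : ι → ℝ, Tendsto ε l (𝓝 0) ∧ ∀ᶠ i in l, i ∈ s → a i = (c + ε i) * b i := by
  classical
  obtain ⟨φ, hφ, heq⟩ := isLittleO_iff_exists_eq_mul.1 h
  refine ⟨s.piecewise φ 0, hφ.piecewise tendsto_const_nhds, ?_⟩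
  filter_upwards [eventually_inf_principal.1 heq] with i hi his
  rw [Set.piecewise_eq_of_mem _ _ _ his]
  linear_combination (hi his).trans (Pi.mul_apply φ b i)

theorem exists_abs_ramseyNumber_sub_le {ε : ℝ} (hε : 0 < ε) :
    ∃ m₀, ∀ m ≥ m₀, ∀ n, (m = n ∨ 2 * m = n) →
      |(ramseyNumber (cycleGraph (2 * m)) (fanGraph n) : ℝ) - (2 * n + 2 * m)| ≤ ε * n := by
  obtain ⟨m₁, hm₁⟩ := ramseyArrows_cycleGraph_fanGraph (ε := ε / (2 * (5 + ε))) (by positivity)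
  obtain ⟨m₂, hm₂⟩ := exists_nat_ge (2 / ε)
  refine ⟨m₁ + m₂ + 1, fun m hm n hmn ↦ ?_⟩
  have hmn' : (m : ℝ) ≤ n := by exact_mod_cast (by omega : m ≤ n)
  have hn : (1 : ℝ) ≤ n := by exact_mod_cast (by omega : 1 ≤ n)
  have hεn : 2 ≤ ε * n := by
    rw [← div_le_iff₀' hε]
    exact hm₂.trans (by exact_mod_cast (by omega : m₂ ≤ n))
  set N := ⌈2 * n + 2 * m + ε / 2 * n⌉₊
  have hleN : 2 * n + 2 * m + ε / 2 * n ≤ N := Nat.le_ceil _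
  have hNlt : N < 2 * n + 2 * m + ε / 2 * n + 1 := Nat.ceil_lt_add_one (by positivity)
  have hNpos : 0 < N := Nat.ceil_pos.2 (by positivity)
  have harrows : RamseyArrows (cycleGraph (2 * m)) (fanGraph n) N := by
    refine hm₁ m (by omega) n N (hmn.imp_right Eq.le) (le_trans ?_ hleN)
    gcongr 2 * n + 2 * m + ?_
    rw [div_mul_eq_mul_div, div_le_iff₀ (by positivity)]
    nlinarith
  have hupper : (ramseyNumber (cycleGraph (2 * m)) (fanGraph n) : ℝ) ≤ N := by
    exact_mod_cast ramseyNumber_le_of_ramseyArrows hNpos harrows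
  have hlower : 2 * n + 2 * m ≤ ramseyNumber (cycleGraph (2 * m)) (fanGraph n) + 2 := by
    have hlt (b : ℕ) (hb : b * (2 * m - 1) < n) :=
      lt_ramseyNumber hNpos harrows fun k hk ↦ not_ramseyArrows_fanGraph (b := b)
        cycleGraph_preconnected hk (by rw [Fintype.card_fin]; omega) hb
    rcases hmn with rfl | rfl
    · have := hlt 0 (by omega)
      omega
    · have := hlt 1 (by omega)
      omega
  rify at hlower
  rw [abs_le]
  constructor <;> linarith

theorem isLittleO_ramseyNumber_sub {ι : Type*} {l : Filter ι} {m n : ι → ℕ}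
    (hm : Tendsto m l atTop) (hmn : ∀ᶠ i in l, m i = n i ∨ 2 * m i = n i) :
    (fun i ↦ (ramseyNumber (cycleGraph (2 * m i)) (fanGraph (n i)) : ℝ) - (2 * n i + 2 * m i))
      =o[l] fun i ↦ (n i : ℝ) := by
  refine isLittleO_iff.2 fun ε hε ↦ ?_
  obtain ⟨m₀, hm₀⟩ := exists_abs_ramseyNumber_sub_le hε
  filter_upwards [hm.eventually_ge_atTop m₀, hmn] with i hi hmni
  rw [Real.norm_natCast, Real.norm_eq_abs]
  exact hm₀ _ hi _ hmni

end Asymptotics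

end CycleFan

theorem mainTheorem2 :
    (∃ ε : ℕ → ℝ, Filter.Tendsto ε Filter.atTop (nhds 0) ∧
      ∀ᶠ n : ℕ in Filter.atTop,
        (ramseyNumber (SimpleGraph.cycleGraph (2 * n)) (fanGraph n) : ℝ) = (4 + ε n) * (n : ℝ)) ∧
    (∃ ε : ℕ → ℝ, Filter.Tendsto ε Filter.atTop (nhds 0) ∧
      ∀ᶠ n : ℕ in Filter.atTop, Even n →
        (ramseyNumber (SimpleGraph.cycleGraph n) (fanGraph n) : ℝ) = (3 + ε n) * (n : ℝ)) := by
  constructor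
  · have hlittleO := CycleFan.isLittleO_ramseyNumber_sub (m := id) (n := id) Filter.tendsto_id
      (.of_forall fun _ ↦ .inl rfl)
    obtain ⟨ε, hε, heq⟩ := CycleFan.exists_tendsto_zero_eq_add_mul (s := Set.univ) (c := 4)
      (a := fun n : ℕ ↦ ramseyNumber (SimpleGraph.cycleGraph (2 * n)) (fanGraph n))
      ((hlittleO.congr_left fun n ↦ by rw [id]; ring).mono inf_le_left)
    exact ⟨ε, hε, heq.mono fun n hn ↦ hn trivial⟩
  · have hlittleO := CycleFan.isLittleO_ramseyNumber_sub (m := (· / 2)) (n := id)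
      (l := Filter.atTop ⊓ Filter.principal {n | Even n})
      ((Nat.tendsto_div_const_atTop two_ne_zero).mono_left inf_le_left)
      (Filter.eventually_inf_principal.2 (.of_forall fun n hn ↦
        .inr (Nat.two_mul_div_two_of_even hn)))
    refine CycleFan.exists_tendsto_zero_eq_add_mul (s := {n | Even n}) (hlittleO.congr' ?_ .rfl)
    refine Filter.eventually_inf_principal.2 (.of_forall fun n hn ↦ ?_)
    obtain ⟨m, rfl⟩ := even_iff_exists_two_mul.1 hn
    beta_reduce
    rw [Nat.mul_div_cancel_left m two_pos, id]
    push_cast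
    ring
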